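/- Fix finite-dimensional Hilbert spaces with reference orthonormal bases and write states (positive semidefinite matrices of trace one) as density matrices in these bases. A state or Kraus operator is real if all its matrix entries are real; $\rho^*$ is the entrywise complex conjugate, $\mathrm{Re}(\rho)=\frac12(\rho+\rho^*)$, and $|\psi^*\rangle$ is the entrywise conjugate of $|\psi\rangle$. Let $F(\rho,\sigma)=\mathrm{Tr}\sqrt{\sqrt\rho\,\sigma\sqrt\rho}$ and $$M_{\mathrm{Re}}(\rho)=1-F(\rho,\mathrm{Re}(\rho)),\qquad M_{\mathrm g}(\rho)=1-\max_{\sigma\text{ a real state}}F(\rho,\sigma)^2 .$$ Then $M=M_{\mathrm{Re}}$ is an imaginarity measure, that is, for all states in all finite dimensions: (M1) $M(\rho)\ge 0$, with $M(\rho)=0$ if and only if $\rho$ is real; (M2) $M(\Phi(\rho))\le M(\rho)$ for every real operation $\Phi(\rho)=\sum_l K_l\rho K_l^\dagger$ (a finite sum with real $K_l$ and $\sum_l K_l^\dagger K_l=I$; the output dimension may differ from the input dimension); (M3) $\sum_l \mathrm{Tr}(K_l\rho K_l^T)\,M\!\left[\frac{K_l\rho K_l^T}{\mathrm{Tr}(K_l\rho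 K_l^T)}\right]\le M(\rho)$ for every such $\{K_l\}$, where terms of probability zero count as $0$; (M4) $M(\sum_j p_j\rho_j)\le\sum_j p_jM(\rho_j)$ for every finite probability distribution $\{p_j\}$ and states $\{\rho_j\}$; (M5) $M[p\rho_1\oplus(1-p)\rho_2]=pM(\rho_1)+(1-p)M(\rho_2)$ for all $p\in[0,1]$ and all states $\rho_1,\rho_2$ (of possibly different dimensions). Moreover: 1. For every state $\rho$, $0\le M_{\mathrm{Re}}(\rho)\le 1-\frac{\sqrt2}{2}$, and $M_{\mathrm{Re}}(\rho)=0$ if and only if $\rho$ is real. For any two distinct vectors $|j\rangle,|k\rangle$ of the reference basis, the upper bound is attained at the pure state $\frac{|j\rangle+\mathrm i|k\rangle}{\sqrt2}$, in particular at $|{+\mathrm i}\rangle=\frac{|0\rangle+\mathrm i|1\rangle}{\sqrt2}$. 2. For every pure state (unit vector) $|\psi\rangle$, $M_{\mathrm{Re}}(|\psi\rangle)=1-\frac1{\sqrt2}\sqrt{1+|\langle\psi|\psi^*\rangle|^2}$. 3. For every pure state $|\psi\rangle$, the maximum defining $M_{\mathrm g}(|\psi\rangle)$ is attained and $M_{\mathrm{Re}}(|\psi\rangle)=1-\frac1{\sqrt2}\sqrt{1+(1-2M_{\mathrm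 g}(|\psi\rangle))^2}$. 4. Let $\{\Pi_i\}$ be a finite family of rank-one orthogonal projections with real entries and let $\rho$ be a state such that $\sum_i\Pi_i\rho\Pi_i$ is again a state (as is always the case if the $\Pi_i$ are mutually orthogonal with $\sum_i\Pi_i=I$). Then $$M_{\mathrm{Re}}\Big(\sum_i\Pi_i\rho\Pi_i\Big)=\sum_i p_i\,M_{\mathrm{Re}}(\rho_i),\qquad p_i=\mathrm{Tr}(\Pi_i\rho\Pi_i),\quad \rho_i=\tfrac1{p_i}\Pi_i\rho\Pi_i ,$$ where terms with $p_i=0$ count as $0$. -/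

import Mathlib

open scoped MatrixOrder ComplexOrder

noncomputable section

namespace Imaginarity

open Matrix

/-- `ρ` is a quantum state (density matrix), written in the reference basis `(|j⟩)_{j : n}`. -/
def IsState {n : Type} [Fintype n] (ρ : Matrix n n ℂ) : Prop :=
  ρ.PosSemidef ∧ ρ.trace = 1

/-- A matrix all of whose entries in the reference basis are real. -/
def IsReal {m n : Type} (A : Matrix m n ℂ) : Prop :=
  ∀ i j, (A i j).im = 0

/-- The real part `Re ρ = (ρ + ρ*) / 2`, where `ρ*` is the entrywise complex conjugate. -/
def rePart {n : Type} (ρ : Matrix n n ℂ) : Matrix n n ℂ :=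
  (1 / 2 : ℂ) • (ρ + ρ.map (starRingEnd ℂ))

/-- The fidelity `F(ρ, σ) = Tr √(√ρ σ √ρ)`. For positive semidefinite `ρ`, `σ` the square roots
are the positive semidefinite ones and the trace is real. -/
def fidelity {n : Type} [Fintype n] [DecidableEq n] (ρ σ : Matrix n n ℂ) : ℝ :=
  (CFC.sqrt (CFC.sqrt ρ * σ * CFC.sqrt ρ)).trace.re

/-- `M_Re(ρ) = 1 - F(ρ, Re ρ)`. -/
def MRe (n : Type) [Fintype n] [DecidableEq n] (ρ : Matrix n n ℂ) : ℝ :=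
  1 - fidelity ρ (rePart ρ)

/-- The set of squared fidelities of `ρ` with the real states. -/
def sqFidelitiesToReal {n : Type} [Fintype n] [DecidableEq n] (ρ : Matrix n n ℂ) : Set ℝ :=
  {x | ∃ σ : Matrix n n ℂ, IsState σ ∧ IsReal σ ∧ x = fidelity ρ σ ^ 2}

/-- The geometric imaginarity `M_g(ρ) = 1 - max_{σ real state} F(ρ, σ)²`. -/
def Mg {n : Type} [Fintype n] [DecidableEq n] (ρ : Matrix n n ℂ) : ℝ :=
  1 - sSup (sqFidelitiesToReal ρ)

/-- The projector `|ψ⟩⟨ψ|`. -/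
def ketBra {n : Type} (ψ : n → ℂ) : Matrix n n ℂ :=
  vecMulVec ψ (star ψ)

/-- The vector `(|j⟩ + i |k⟩) / √2`. -/
def plusI {n : Type} [DecidableEq n] (j k : n) : n → ℂ :=
  ((Real.sqrt 2 : ℝ) : ℂ)⁻¹ • (Pi.single j 1 + Pi.single k Complex.I)

/-- `K` is a finite family of Kraus operators, real in the reference bases, of a real operation
`Φ(ρ) = ∑ l, K l * ρ * (K l)ᴴ` (completely positive and trace preserving). -/
def IsRealKraus {m n ι : Type} [Fintype m] [Fintype n] [DecidableEq n] [Fintype ι]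
    (K : ι → Matrix m n ℂ) : Prop :=
  (∀ l, IsReal (K l)) ∧ ∑ l, (K l)ᴴ * K l = 1

/-- The direct sum of two matrices. -/
def directSum {m n : Type} (A : Matrix m m ℂ) (B : Matrix n n ℂ) : Matrix (m ⊕ n) (m ⊕ n) ℂ :=
  fromBlocks A 0 0 B

/-- Imaginarity measures. The function `M` is given on all square matrices, in all finite
dimensions, but only its values at quantum states matter: a normalized post-measurement state
with probability zero contributes `0` to the sum in `prob_mono`. -/
structure IsImaginarityMeasure
    (M : ∀ (n : Type) [Fintype n] [DecidableEq n], Matrix n n ℂ → ℝ) : Prop where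
  /-- Nonnegativity. -/
  nonneg : ∀ (n : Type) [Fintype n] [DecidableEq n] (ρ : Matrix n n ℂ),
    IsState ρ → 0 ≤ M n ρ
  /-- Faithfulness. -/
  faithful : ∀ (n : Type) [Fintype n] [DecidableEq n] (ρ : Matrix n n ℂ),
    IsState ρ → (M n ρ = 0 ↔ IsReal ρ)
  /-- Monotonicity under real operations. -/
  mono : ∀ (m n ι : Type) [Fintype m] [DecidableEq m] [Fintype n] [DecidableEq n] [Fintype ι]
    (K : ι → Matrix m n ℂ) (ρ : Matrix n n ℂ), IsRealKraus K → IsState ρ →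
    M m (∑ l, K l * ρ * (K l)ᴴ) ≤ M n ρ
  /-- Probabilistic monotonicity under real operations. -/
  prob_mono : ∀ (m n ι : Type) [Fintype m] [DecidableEq m] [Fintype n] [DecidableEq n]
    [Fintype ι] (K : ι → Matrix m n ℂ) (ρ : Matrix n n ℂ), IsRealKraus K → IsState ρ →
    ∑ l, (K l * ρ * (K l)ᵀ).trace.re *
      M m ((K l * ρ * (K l)ᵀ).trace⁻¹ • (K l * ρ * (K l)ᵀ)) ≤ M n ρ
  /-- Convexity. -/
  convex : ∀ (n ι : Type) [Fintype n] [DecidableEq n] [Fintype ι]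
    (p : ι → ℝ) (ρ : ι → Matrix n n ℂ), (∀ j, 0 ≤ p j) → ∑ j, p j = 1 → (∀ j, IsState (ρ j)) →
    M n (∑ j, (p j : ℂ) • ρ j) ≤ ∑ j, p j * M n (ρ j)
  /-- Additivity for direct sum states. -/
  add_directSum : ∀ (m n : Type) [Fintype m] [DecidableEq m] [Fintype n] [DecidableEq n]
    (p : ℝ) (ρ₁ : Matrix m m ℂ) (ρ₂ : Matrix n n ℂ), 0 ≤ p → p ≤ 1 → IsState ρ₁ → IsState ρ₂ →
    M (m ⊕ n) (directSum ((p : ℂ) • ρ₁) (((1 - p : ℝ) : ℂ) • ρ₂)) =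
      p * M m ρ₁ + (1 - p) * M n ρ₂

/-- `P` is a rank-one orthogonal projection with real entries. -/
def IsRealRankOneProj {n : Type} [Fintype n] (P : Matrix n n ℂ) : Prop :=
  P.IsHermitian ∧ P * P = P ∧ P.rank = 1 ∧ IsReal P

end Imaginarity

end

noncomputable section

namespace Imaginarity

open Matrix

/-! ### Polar decomposition. -/

section Polar

variable {m n : Type*} [Fintype m] [Fintype n] [DecidableEq n]

/-! Everything about mixed states rests on one variational formula: `F(ρ, σ)` is the maximum of `Re
Tr X` over all `X` for which the block matrix `[[ρ, X], [Xᴴ, σ]]` is positive semidefinite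
(`exists_coupling_eq`, `IsCoupling.re_trace_le`). Such couplings are stable under sums, nonnegative
scaling, conjugation by Kraus operators and passage to diagonal blocks. Transporting optimal
couplings therefore gives joint superadditivity, strong monotonicity under measurements and
additivity on direct sums. Since `Re` commutes with sums, real scalings and real Kraus maps,
(M2)–(M5) follow on taking `σ = Re ρ`. Compressing the block matrix by `(1, -1)` gives `2F ≤ Tr ρ +
Tr σ` with equality only for `ρ = σ`, which is (M1). The upper bound holds because `ρ/√2` is a
coupling of `ρ` and `Re ρ ≥ ρ/2`.

For pure states `F(ψ, σ)² = ⟨ψ|σ|ψ⟩`. A real `σ` has the same expectation in `ψ` and `ψ*`, so this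
is at most half the top eigenvalue of `|ψ⟩⟨ψ| + |ψ*⟩⟨ψ*|`, namely `(1 + |⟨ψ|ψ*⟩|)/2`; the real part
of `ψ`, after a suitable phase, attains it. The last claim reads `0 = 0`: real rank-one projections
leave only real states. -/

theorem exists_hermitian_pseudoinverse {S : Matrix n n ℂ} (hS : S.IsHermitian) :
    ∃ T : Matrix n n ℂ, T.IsHermitian ∧ S * T = T * S ∧ S * T * S = S := by
  have hS' : IsSelfAdjoint S := hS
  have hc : ∀ f : ℝ → ℝ, ContinuousOn f (spectrum ℝ S) := fun f =>
    (Matrix.finite_real_spectrum (A := S)).continuousOn f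
  have hid : cfc (fun x : ℝ => x) S = S := cfc_id' ℝ S
  have h₁ : S * cfc (fun x : ℝ => x⁻¹) S = cfc (fun x : ℝ => x * x⁻¹) S := by
    rw [cfc_mul (fun x : ℝ => x) (fun x : ℝ => x⁻¹) S (hc _) (hc _), hid]
  have h₂ : cfc (fun x : ℝ => x⁻¹) S * S = cfc (fun x : ℝ => x * x⁻¹) S := by
    simp_rw [mul_comm _ (_ : ℝ)⁻¹]
    rw [cfc_mul (fun x : ℝ => x⁻¹) (fun x : ℝ => x) S (hc _) (hc _), hid]
  -- With the convention `0⁻¹ = 0`, the function `x⁻¹` of `S` inverts `S` on its range and vanishes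
  -- on its kernel.
  refine ⟨cfc (fun x : ℝ => x⁻¹) S, cfc_predicate _ S, h₁.trans h₂.symm, ?_⟩
  have h₃ := cfc_mul (fun x : ℝ => x * x⁻¹) (fun x : ℝ => x) S (hc _) (hc _)
  simp only [mul_inv_mul_cancel] at h₃
  rwa [hid, ← h₁, eq_comm] at h₃

/-- Polar decomposition with a contraction as its isometric factor. -/
theorem exists_polar (P : Matrix m n ℂ) :
    ∃ V : Matrix m n ℂ, (1 - Vᴴ * V).PosSemidef ∧ P = V * CFC.sqrt (Pᴴ * P) ∧
      Vᴴ * P = CFC.sqrt (Pᴴ * P) := by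
  have hP : (Pᴴ * P).PosSemidef := posSemidef_conjTranspose_mul_self P
  set S := CFC.sqrt (Pᴴ * P)
  have hS : S.IsHermitian := (CFC.sqrt_nonneg (Pᴴ * P)).posSemidef.1
  have hSS : S * S = Pᴴ * P := CFC.sqrt_mul_sqrt_self _ hP.nonneg
  obtain ⟨T, hT, hc, hSTS⟩ := exists_hermitian_pseudoinverse hS
  have hVP : (P * T)ᴴ * P = S := by
    rw [conjTranspose_mul, hT.eq, Matrix.mul_assoc, ← hSS, ← Matrix.mul_assoc, ← hc, hSTS]
  have hE : (P * T)ᴴ * (P * T) = S * T := by rw [← Matrix.mul_assoc, hVP]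
  -- For `V = P T` the matrix `Vᴴ V = S T` is an orthogonal projection, so `1 - Vᴴ V` is the Gram
  -- matrix of `1 - S T`.
  refine ⟨P * T, ?_, ?_, hVP⟩
  · have h : 1 - (P * T)ᴴ * (P * T) = (1 - S * T)ᴴ * (1 - S * T) := by
      rw [hE, conjTranspose_sub, conjTranspose_mul S T, hS.eq, hT.eq, ← hc, conjTranspose_one]
      have : S * T * (S * T) = S * T := by rw [← Matrix.mul_assoc, hSTS]
      simp [Matrix.sub_mul, Matrix.mul_sub, this]
    rw [h]; exact posSemidef_conjTranspose_mul_self _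
  -- The defect `D = P (1 - T S)` satisfies `Dᴴ P = 0`, hence `Dᴴ D = 0` and `D = 0`.
  · have h : (P - P * T * S)ᴴ * P = 0 := by
      rw [conjTranspose_sub, Matrix.sub_mul, conjTranspose_mul (P * T) S, Matrix.mul_assoc, hVP,
        hS.eq, hSS, sub_self]
    have h : P - P * T * S = 0 := by
      rw [Matrix.mul_assoc P] at h ⊢
      rw [← conjTranspose_mul_self_eq_zero, Matrix.mul_sub, ← Matrix.mul_assoc _ P, h]
      simp
    exact sub_eq_zero.mp h

end Polar

/-! ### Fidelity as a maximum over couplings. -/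

section Fidelity

variable {m n : Type} [Fintype m] [Fintype n]

theorem trace_conjTranspose_mul_re_symm (A B : Matrix m n ℂ) :
    (Aᴴ * B).trace.re = (Bᴴ * A).trace.re := by
  rw [← conjTranspose_conjTranspose (Aᴴ * B), trace_conjTranspose, conjTranspose_mul]
  simp

theorem two_mul_re_trace_le (A B : Matrix m n ℂ) :
    2 * (Aᴴ * B).trace.re ≤ (Aᴴ * A).trace.re + (Bᴴ * B).trace.re := by
  have h := (posSemidef_conjTranspose_mul_self (A - B)).trace_nonneg
  have h' := (Complex.le_def.1 h).1
  simp only [conjTranspose_sub, Matrix.mul_sub, Matrix.sub_mul, trace_sub, Complex.sub_re,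
    Complex.zero_re] at h'
  have := trace_conjTranspose_mul_re_symm A B
  linarith

theorem re_trace_mono {A B : Matrix n n ℂ} (h : (B - A).PosSemidef) : A.trace.re ≤ B.trace.re := by
  have h' := (Complex.le_def.1 h.trace_nonneg).1
  simp only [trace_sub, Complex.sub_re, Complex.zero_re] at h'
  linarith

/-- `X` is an off-diagonal block completing `ρ` and `σ` to a positive semidefinite matrix. -/
def IsCoupling (ρ σ X : Matrix n n ℂ) : Prop :=
  (fromBlocks ρ X Xᴴ σ).PosSemidef

theorem fromBlocks_gram {l m n : Type} [Fintype l] (P : Matrix l m ℂ) (Q : Matrix l n ℂ) :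
    fromBlocks (Pᴴ * P) (Pᴴ * Q) (Qᴴ * P) (Qᴴ * Q) = (fromCols P Q)ᴴ * fromCols P Q := by
  rw [conjTranspose_fromCols_eq_fromRows_conjTranspose, fromRows_mul_fromCols]

theorem _root_.Matrix.PosSemidef.fromBlocks_diagonal {A : Matrix m m ℂ} {B : Matrix n n ℂ}
    (hA : A.PosSemidef) (hB : B.PosSemidef) : (fromBlocks A 0 0 B).PosSemidef := by
  classical
  have h := (hA.conjTranspose_mul_mul_same (fromCols 1 0 : Matrix m (m ⊕ n) ℂ)).add
    (hB.conjTranspose_mul_mul_same (fromCols 0 1 : Matrix n (m ⊕ n) ℂ))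
  convert h using 1
  ext (i | i) (j | j) <;>
    simp [conjTranspose_fromCols_eq_fromRows_conjTranspose, Matrix.mul_fromCols, fromRows_mul]

variable [DecidableEq n]

/-- If `V` is the polar factor of `√σ √ρ`, then `X = √ρ Vᴴ √σ` is optimal. Its block matrix is the
Gram matrix of `(V√ρ, √σ)` plus the block `√ρ (1 - Vᴴ V) √ρ`, so it suffices that `V` is a
contraction. -/
theorem exists_coupling_eq {ρ σ : Matrix n n ℂ} (hρ : ρ.PosSemidef) (hσ : σ.PosSemidef) :
    ∃ X, IsCoupling ρ σ X ∧ X.trace.re = fidelity ρ σ := by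
  set A := CFC.sqrt ρ
  set B := CFC.sqrt σ
  have hA : A.IsHermitian := (CFC.sqrt_nonneg ρ).posSemidef.1
  have hB : B.IsHermitian := (CFC.sqrt_nonneg σ).posSemidef.1
  have hAA : A * A = ρ := CFC.sqrt_mul_sqrt_self _ hρ.nonneg
  have hBB : B * B = σ := CFC.sqrt_mul_sqrt_self _ hσ.nonneg
  obtain ⟨V, hV, -, hVP⟩ := exists_polar (B * A)
  have hBA : (B * A)ᴴ * (B * A) = A * σ * A := by
    rw [conjTranspose_mul, hA.eq, hB.eq, ← hBB]; simp only [Matrix.mul_assoc]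
  refine ⟨A * Vᴴ * B, ?_, ?_⟩
  · have h₁ := (hV.conjTranspose_mul_mul_same A)
    have h₂ := posSemidef_conjTranspose_mul_self (fromCols (V * A) B)
    rw [← fromBlocks_gram] at h₂
    unfold IsCoupling
    convert (h₁.fromBlocks_diagonal PosSemidef.zero).add h₂ using 1
    rw [fromBlocks_add]
    simp [conjTranspose_mul, hA.eq, hB.eq, hAA, hBB, Matrix.mul_sub, Matrix.sub_mul,
      Matrix.mul_assoc]
  · rw [trace_mul_comm, ← Matrix.mul_assoc, trace_mul_comm, hVP, hBA]
    rfl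

/-- Factoring the block matrix as a Gram matrix of `(P, Q)` gives `X = Pᴴ Q`. Polar decompositions
of `P`, `Q` and `√σ √ρ` turn its trace into `Tr (Vᴴ V' U S)` with contractions `V, V', U` and `Tr S
= F(ρ, σ)`. Writing `S = R R` and applying the arithmetic–geometric mean bound to `V R` and `V' U R`
finishes. -/
theorem IsCoupling.re_trace_le {ρ σ X : Matrix n n ℂ} (h : IsCoupling ρ σ X) :
    X.trace.re ≤ fidelity ρ σ := by
  obtain ⟨W, hW⟩ := CStarAlgebra.nonneg_iff_eq_star_mul_self.1 (Matrix.PosSemidef.nonneg h)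
  set P := W.toCols₁
  set Q := W.toCols₂
  have hWPQ : W = fromCols P Q := (fromCols_toCols W).symm
  rw [star_eq_conjTranspose, hWPQ, ← fromBlocks_gram, fromBlocks_inj] at hW
  obtain ⟨hρ, rfl, -, hσ⟩ := hW
  have hρ' : ρ.PosSemidef := hρ ▸ posSemidef_conjTranspose_mul_self P
  have hσ' : σ.PosSemidef := hσ ▸ posSemidef_conjTranspose_mul_self Q
  set A := CFC.sqrt ρ
  set B := CFC.sqrt σ
  have hA : A.IsHermitian := (CFC.sqrt_nonneg ρ).posSemidef.1
  have hB : B.IsHermitian := (CFC.sqrt_nonneg σ).posSemidef.1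
  have hBB : B * B = σ := CFC.sqrt_mul_sqrt_self _ hσ'.nonneg
  have hBA : (B * A)ᴴ * (B * A) = A * σ * A := by
    rw [conjTranspose_mul, hA.eq, hB.eq, ← hBB]; simp only [Matrix.mul_assoc]
  obtain ⟨V, hV, hPV, -⟩ := exists_polar P
  obtain ⟨V', hV', hQV, -⟩ := exists_polar Q
  obtain ⟨U, hU, hBAU, -⟩ := exists_polar (B * A)
  rw [← hρ] at hPV
  rw [← hσ] at hQV
  rw [hBA] at hBAU
  set S := CFC.sqrt (A * σ * A)
  have hSpos : S.PosSemidef := (CFC.sqrt_nonneg _).posSemidef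
  set R := CFC.sqrt S
  have hR : R.IsHermitian := (CFC.sqrt_nonneg S).posSemidef.1
  have hRR : R * R = S := CFC.sqrt_mul_sqrt_self _ hSpos.nonneg
  have key : (Pᴴ * Q).trace = ((V * R)ᴴ * (V' * U * R)).trace := by
    rw [hPV, hQV, conjTranspose_mul, conjTranspose_mul, hA.eq, hR.eq, Matrix.mul_assoc,
      trace_mul_comm, Matrix.mul_assoc, Matrix.mul_assoc, hBAU, ← hRR, Matrix.mul_assoc R,
      trace_mul_comm R]
    simp only [Matrix.mul_assoc]
  have h₁ : ((V * R)ᴴ * (V * R)).trace.re ≤ S.trace.re := by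
    apply re_trace_mono
    have := hV.conjTranspose_mul_mul_same R
    convert this using 1
    simp only [hR.eq, Matrix.mul_sub, Matrix.sub_mul, ← hRR, conjTranspose_mul, Matrix.mul_one,
      Matrix.mul_assoc]
  -- The contractions are removed one at a time: the defects of `U` and of `V'` add up to the
  -- difference.
  have h₂ : ((V' * U * R)ᴴ * (V' * U * R)).trace.re ≤ S.trace.re := by
    apply re_trace_mono
    have := (hU.conjTranspose_mul_mul_same R).add (hV'.conjTranspose_mul_mul_same (U * R))
    convert this using 1
    simp only [hR.eq, Matrix.mul_sub, Matrix.sub_mul, ← hRR, conjTranspose_mul, Matrix.mul_one,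
      Matrix.mul_assoc]
    abel
  have h₃ := two_mul_re_trace_le (V * R) (V' * U * R)
  rw [key]
  change _ ≤ S.trace.re
  linarith

end Fidelity

/-! ### Stability of couplings and the resulting fidelity inequalities. -/

section Coupling

variable {m n ι : Type}

namespace IsCoupling

theorem posSemidef_left {ρ σ X : Matrix n n ℂ} (h : IsCoupling ρ σ X) : ρ.PosSemidef := by
  exact PosSemidef.submatrix h (Sum.inl : n → n ⊕ n)

theorem zero : IsCoupling (0 : Matrix n n ℂ) 0 0 := by
  simpa [IsCoupling] using (PosSemidef.zero : (0 : Matrix (n ⊕ n) (n ⊕ n) ℂ).PosSemidef)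

theorem add {ρ σ X ρ' σ' X' : Matrix n n ℂ} (h : IsCoupling ρ σ X) (h' : IsCoupling ρ' σ' X') :
    IsCoupling (ρ + ρ') (σ + σ') (X + X') := by
  simpa [IsCoupling, fromBlocks_add] using PosSemidef.add h h'

theorem sum [Fintype ι] {ρ σ X : ι → Matrix n n ℂ} (h : ∀ i, IsCoupling (ρ i) (σ i) (X i)) :
    IsCoupling (∑ i, ρ i) (∑ i, σ i) (∑ i, X i) := by
  classical
  induction (Finset.univ : Finset ι) using Finset.induction_on with
  | empty => simpa using zero
  | insert i s hi ih => simpa [Finset.sum_insert hi] using (h i).add ih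

theorem smul {ρ σ X : Matrix n n ℂ} (h : IsCoupling ρ σ X) {a : ℝ} (ha : 0 ≤ a) :
    IsCoupling ((a : ℂ) • ρ) ((a : ℂ) • σ) ((a : ℂ) • X) := by
  have := PosSemidef.smul h (Complex.zero_le_real.2 ha)
  simpa [IsCoupling, fromBlocks_smul] using this

variable [Fintype n]

theorem conj [Fintype m] {ρ σ X : Matrix n n ℂ} (h : IsCoupling ρ σ X) (K : Matrix m n ℂ) :
    IsCoupling (K * ρ * Kᴴ) (K * σ * Kᴴ) (K * X * Kᴴ) := by
  have := PosSemidef.mul_mul_conjTranspose_same h (fromBlocks K 0 0 K)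
  simpa [IsCoupling, fromBlocks_conjTranspose, fromBlocks_multiply, Matrix.mul_assoc] using this

theorem quadratic_nonneg {ρ σ X : Matrix n n ℂ} (h : IsCoupling ρ σ X) :
    (ρ + σ - X - Xᴴ).PosSemidef := by
  classical
  have := PosSemidef.conjTranspose_mul_mul_same h (fromRows 1 (-1) : Matrix (n ⊕ n) n ℂ)
  convert this using 1
  rw [Matrix.mul_assoc]
  simp [conjTranspose_fromRows_eq_fromCols_conjTranspose, fromBlocks_mul_fromRows,
    fromCols_mul_fromRows]
  abel

theorem two_mul_re_trace_le {ρ σ X : Matrix n n ℂ} (h : IsCoupling ρ σ X) :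
    2 * X.trace.re ≤ ρ.trace.re + σ.trace.re := by
  have := (Complex.le_def.1 h.quadratic_nonneg.trace_nonneg).1
  simp [trace_sub, trace_add, trace_conjTranspose] at this
  linarith

/-- Equality makes the compression by `(1, -1)` a positive semidefinite matrix of trace zero, so
`(1, -1)` lies in the kernel of the block matrix. Its rows then say `ρ = X` and `Xᴴ = σ`. -/
theorem eq_of_trace_eq {ρ σ X : Matrix n n ℂ} (h : IsCoupling ρ σ X)
    (ht : 2 * X.trace.re = ρ.trace.re + σ.trace.re) : ρ = σ := by
  classical
  have h₀ : ρ + σ - X - Xᴴ = 0 := by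
    rw [← h.quadratic_nonneg.trace_eq_zero_iff]
    refine Complex.ext ?_ (Complex.le_def.1 h.quadratic_nonneg.trace_nonneg).2.symm
    simp [trace_sub, trace_add, trace_conjTranspose]
    linarith
  obtain ⟨W, hW⟩ := CStarAlgebra.nonneg_iff_eq_star_mul_self.1 (Matrix.PosSemidef.nonneg h)
  rw [star_eq_conjTranspose] at hW
  have h₁ : W * (fromRows 1 (-1) : Matrix (n ⊕ n) n ℂ) = 0 := by
    rw [← conjTranspose_mul_self_eq_zero, conjTranspose_mul, Matrix.mul_assoc,
      ← Matrix.mul_assoc Wᴴ, ← hW, ← h₀]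
    simp [conjTranspose_fromRows_eq_fromCols_conjTranspose, fromBlocks_mul_fromRows,
      fromCols_mul_fromRows]
    abel
  have h₂ : fromBlocks ρ X Xᴴ σ * (fromRows 1 (-1) : Matrix (n ⊕ n) n ℂ) = 0 := by
    rw [hW, Matrix.mul_assoc, h₁, Matrix.mul_zero]
  rw [fromBlocks_mul_fromRows, ← fromRows_zero, fromRows_inj.eq_iff] at h₂
  simp only [Matrix.mul_one, Matrix.mul_neg, ← sub_eq_add_neg, sub_eq_zero] at h₂
  have := h₂.1
  rw [← h₂.2, ← h₂.1, h.posSemidef_left.1.eq]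

end IsCoupling

variable [Fintype m] [Fintype n] [Fintype ι] [DecidableEq m] [DecidableEq n]

theorem fidelity_self {ρ : Matrix n n ℂ} (hρ : ρ.PosSemidef) : fidelity ρ ρ = ρ.trace.re := by
  have h : CFC.sqrt ρ * ρ * CFC.sqrt ρ = ρ * ρ := by
    have := CFC.sqrt_mul_sqrt_self ρ hρ.nonneg
    calc _ = CFC.sqrt ρ * (CFC.sqrt ρ * CFC.sqrt ρ) * CFC.sqrt ρ := by rw [this]
      _ = (CFC.sqrt ρ * CFC.sqrt ρ) * (CFC.sqrt ρ * CFC.sqrt ρ) := by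
        simp only [Matrix.mul_assoc]
      _ = _ := by rw [this]
  rw [fidelity, h, CFC.sqrt_mul_self ρ hρ.nonneg]

theorem fidelity_le {ρ σ : Matrix n n ℂ} (hρ : ρ.PosSemidef) (hσ : σ.PosSemidef) :
    2 * fidelity ρ σ ≤ ρ.trace.re + σ.trace.re := by
  obtain ⟨X, hX, h⟩ := exists_coupling_eq hρ hσ
  exact h ▸ hX.two_mul_re_trace_le

theorem eq_of_fidelity_eq {ρ σ : Matrix n n ℂ} (hρ : ρ.PosSemidef) (hσ : σ.PosSemidef)
    (h : 2 * fidelity ρ σ = ρ.trace.re + σ.trace.re) : ρ = σ := by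
  obtain ⟨X, hX, hF⟩ := exists_coupling_eq hρ hσ
  exact hX.eq_of_trace_eq (hF ▸ h)

/-- Joint superadditivity of the fidelity. -/
theorem sum_fidelity_le {ρ σ : ι → Matrix n n ℂ} (hρ : ∀ i, (ρ i).PosSemidef)
    (hσ : ∀ i, (σ i).PosSemidef) :
    ∑ i, fidelity (ρ i) (σ i) ≤ fidelity (∑ i, ρ i) (∑ i, σ i) := by
  choose X hX h using fun i => exists_coupling_eq (hρ i) (hσ i)
  have := (IsCoupling.sum hX).re_trace_le
  simpa [trace_sum, h] using this

/-- Joint strong monotonicity of the fidelity under a measurement. -/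
theorem fidelity_le_sum {K : ι → Matrix m n ℂ} (hK : ∑ l, (K l)ᴴ * K l = 1) {ρ σ : Matrix n n ℂ}
    (hρ : ρ.PosSemidef) (hσ : σ.PosSemidef) :
    fidelity ρ σ ≤ ∑ l, fidelity (K l * ρ * (K l)ᴴ) (K l * σ * (K l)ᴴ) := by
  obtain ⟨X, hX, h⟩ := exists_coupling_eq hρ hσ
  -- Completeness of the Kraus family preserves the total trace of the optimal `X`, while each `K X
  -- Kᴴ` is a coupling of the two outputs.
  calc fidelity ρ σ = ∑ l, (K l * X * (K l)ᴴ).trace.re := by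
        rw [← h, ← Complex.re_sum]
        congr 1
        calc X.trace = (X * ∑ l, (K l)ᴴ * K l).trace := by rw [hK, Matrix.mul_one]
          _ = _ := by
            rw [Matrix.mul_sum, trace_sum]
            refine Finset.sum_congr rfl fun l _ => ?_
            rw [Matrix.mul_assoc (K l), trace_mul_comm (K l), Matrix.mul_assoc]
    _ ≤ _ := Finset.sum_le_sum fun l _ => (hX.conj (K l)).re_trace_le

theorem fidelity_smul {a : ℝ} (ha : 0 ≤ a) {ρ σ : Matrix n n ℂ}
    (hρ : ρ.PosSemidef) (hσ : σ.PosSemidef) :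
    fidelity ((a : ℂ) • ρ) ((a : ℂ) • σ) = a * fidelity ρ σ := by
  have hA : (CFC.sqrt ρ).PosSemidef := (CFC.sqrt_nonneg ρ).posSemidef
  have h₁ : CFC.sqrt ((a : ℂ) • ρ) = ((√a : ℝ) : ℂ) • CFC.sqrt ρ := by
    refine CFC.sqrt_unique ?_ (hA.smul (Complex.zero_le_real.2 (Real.sqrt_nonneg a))).nonneg
    rw [smul_mul_smul_comm, CFC.sqrt_mul_sqrt_self ρ hρ.nonneg, ← Complex.ofReal_mul,
      Real.mul_self_sqrt ha]
  have h₂ : (CFC.sqrt ρ * σ * CFC.sqrt ρ).PosSemidef := by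
    simpa [hA.1.eq] using hσ.conjTranspose_mul_mul_same (CFC.sqrt ρ)
  have h₃ : CFC.sqrt (CFC.sqrt ((a : ℂ) • ρ) * ((a : ℂ) • σ) * CFC.sqrt ((a : ℂ) • ρ)) =
      (a : ℂ) • CFC.sqrt (CFC.sqrt ρ * σ * CFC.sqrt ρ) := by
    refine CFC.sqrt_unique ?_
      ((CFC.sqrt_nonneg _).posSemidef.smul (Complex.zero_le_real.2 ha)).nonneg
    rw [smul_mul_smul_comm, CFC.sqrt_mul_sqrt_self _ h₂.nonneg, h₁, smul_mul_smul_comm,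
      smul_mul_smul_comm, mul_right_comm, ← Complex.ofReal_mul, ← Complex.ofReal_mul,
      ← Complex.ofReal_mul, Real.mul_self_sqrt ha]
  rw [fidelity, h₃, trace_smul, smul_eq_mul, Complex.re_ofReal_mul, fidelity]

end Coupling

/-! ### Real matrices and the real part. -/

section RePart

variable {m n ι : Type}

theorem IsReal.map_conj {A : Matrix m n ℂ} (h : IsReal A) : A.map (starRingEnd ℂ) = A := by
  ext i j
  exact Complex.conj_eq_iff_im.2 (h i j)

theorem IsReal.conjTranspose_eq {A : Matrix m n ℂ} (h : IsReal A) : Aᴴ = Aᵀ := by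
  ext i j
  exact Complex.conj_eq_iff_im.2 (h j i)

theorem IsReal.transpose {A : Matrix m n ℂ} (h : IsReal A) : IsReal Aᵀ := fun i j => h j i

theorem IsReal.smul {A : Matrix m n ℂ} (h : IsReal A) {c : ℂ} (hc : c.im = 0) :
    IsReal (c • A) := fun i j => by simp [hc, h i j]

theorem IsReal.sum [Fintype ι] {A : ι → Matrix m n ℂ} (h : ∀ i, IsReal (A i)) :
    IsReal (∑ i, A i) := fun j k => by simp [Matrix.sum_apply, h _ j k]

theorem rePart_eq_self_iff {ρ : Matrix n n ℂ} : rePart ρ = ρ ↔ IsReal ρ := by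
  refine ⟨fun h i j => ?_, fun h => ?_⟩
  · rw [← h]
    simp [rePart]
  · rw [rePart, h.map_conj, ← two_smul ℂ, smul_smul]
    norm_num

theorem map_conj_posSemidef {ρ : Matrix n n ℂ} (h : ρ.PosSemidef) :
    (ρ.map (starRingEnd ℂ)).PosSemidef := by
  have : ρ.map (starRingEnd ℂ) = ρᴴᵀ := rfl
  rw [this, h.1.eq]
  exact h.transpose

theorem rePart_posSemidef {ρ : Matrix n n ℂ} (h : ρ.PosSemidef) : (rePart ρ).PosSemidef :=
  (h.add (map_conj_posSemidef h)).smul (by norm_num [Complex.le_def])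

theorem rePart_smul (a : ℝ) (ρ : Matrix n n ℂ) :
    rePart ((a : ℂ) • ρ) = (a : ℂ) • rePart ρ := by
  ext i j
  simp [rePart]
  ring

theorem rePart_sum [Fintype ι] (ρ : ι → Matrix n n ℂ) :
    rePart (∑ i, ρ i) = ∑ i, rePart (ρ i) := by
  ext i j
  simp [rePart, Matrix.sum_apply, Finset.mul_sum, Finset.sum_add_distrib, mul_add]

theorem rePart_directSum (A : Matrix m m ℂ) (B : Matrix n n ℂ) :
    rePart (directSum A B) = directSum (rePart A) (rePart B) := by
  ext (i | i) (j | j) <;> simp [rePart, directSum, mul_add]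

variable [Fintype n]

theorem rePart_conj {K : Matrix m n ℂ} (hK : IsReal K) (ρ : Matrix n n ℂ) :
    rePart (K * ρ * Kᴴ) = K * rePart ρ * Kᴴ := by
  rw [hK.conjTranspose_eq, rePart, Matrix.map_mul, Matrix.map_mul, hK.map_conj,
    hK.transpose.map_conj, rePart]
  simp [Matrix.mul_add, Matrix.add_mul]

theorem re_trace_rePart (ρ : Matrix n n ℂ) : (rePart ρ).trace.re = ρ.trace.re := by
  have : (ρ.map (starRingEnd ℂ)).trace = starRingEnd ℂ ρ.trace := by simp [trace]
  rw [rePart, trace_smul, trace_add, this]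
  simp
  ring

theorem trace_eq_ofReal {ρ : Matrix n n ℂ} (h : ρ.PosSemidef) : ρ.trace = (ρ.trace.re : ℂ) :=
  Complex.ext rfl (by simpa using (Complex.le_def.1 h.trace_nonneg).2.symm)

theorem re_trace_nonneg {ρ : Matrix n n ℂ} (h : ρ.PosSemidef) : 0 ≤ ρ.trace.re :=
  (Complex.le_def.1 h.trace_nonneg).1

variable [Fintype m] [Fintype ι]

theorem sum_trace_conj [DecidableEq n] {K : ι → Matrix m n ℂ} (hK : ∑ l, (K l)ᴴ * K l = 1)
    (ρ : Matrix n n ℂ) : ∑ l, (K l * ρ * (K l)ᴴ).trace = ρ.trace := by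
  calc _ = (ρ * ∑ l, (K l)ᴴ * K l).trace := by
        rw [Matrix.mul_sum, trace_sum]
        refine Finset.sum_congr rfl fun l _ => ?_
        rw [Matrix.mul_assoc (K l), trace_mul_comm (K l), Matrix.mul_assoc]
    _ = _ := by rw [hK, Matrix.mul_one]

end RePart

/-! ### The axioms and the upper bound for `MRe`. -/

section Measure

variable {m n ι : Type} [Fintype m] [Fintype n] [Fintype ι] [DecidableEq m] [DecidableEq n]

theorem MRe_nonneg {ρ : Matrix n n ℂ} (h : IsState ρ) : 0 ≤ MRe n ρ := by
  have := fidelity_le h.1 (rePart_posSemidef h.1)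
  rw [re_trace_rePart, h.2] at this
  rw [MRe]
  norm_num at this
  linarith

theorem MRe_eq_zero_iff {ρ : Matrix n n ℂ} (h : IsState ρ) : MRe n ρ = 0 ↔ IsReal ρ := by
  rw [MRe, sub_eq_zero]
  refine ⟨fun hF => ?_, fun hr => ?_⟩
  · refine rePart_eq_self_iff.1 (eq_of_fidelity_eq h.1 (rePart_posSemidef h.1) ?_).symm
    rw [re_trace_rePart, h.2, ← hF]
    norm_num
  · rw [rePart_eq_self_iff.2 hr, fidelity_self h.1, h.2, Complex.one_re]

/-- The fidelity does not decrease when a measurement is made, nor when its outcome is then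
forgotten. -/
theorem MRe_mono {K : ι → Matrix m n ℂ} {ρ : Matrix n n ℂ} (hK : IsRealKraus K) (h : IsState ρ) :
    MRe m (∑ l, K l * ρ * (K l)ᴴ) ≤ MRe n ρ := by
  have hσ := rePart_posSemidef h.1
  refine sub_le_sub_left ((fidelity_le_sum hK.2 h.1 hσ).trans ?_) 1
  refine (sum_fidelity_le (fun l => h.1.mul_mul_conjTranspose_same (K l))
    fun l => hσ.mul_mul_conjTranspose_same (K l)).trans_eq ?_
  simp only [rePart_sum, rePart_conj (hK.1 _)]

/-- Homogeneity of the fidelity removes the normalization of post-measurement states. At trace zero,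
`τ = 0` and both sides vanish, so outcomes of probability zero need no separate treatment later. -/
theorem trace_mul_MRe {τ : Matrix n n ℂ} (h : τ.PosSemidef) :
    τ.trace.re * MRe n (τ.trace⁻¹ • τ) = τ.trace.re - fidelity τ (rePart τ) := by
  have hσ := rePart_posSemidef h
  rcases (re_trace_nonneg h).eq_or_lt with h₀ | h₀
  · have ht : τ.trace = 0 := by rw [trace_eq_ofReal h, ← h₀, Complex.ofReal_zero]
    have hF := fidelity_smul (le_refl (0 : ℝ)) h hσ
    rw [h.trace_eq_zero_iff.1 ht] at hF ⊢
    simpa [rePart] using hF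
  · rw [trace_eq_ofReal h, ← Complex.ofReal_inv, MRe, rePart_smul,
      fidelity_smul (inv_nonneg.2 h₀.le) h hσ, Complex.ofReal_re]
    field_simp

theorem MRe_prob_mono {K : ι → Matrix m n ℂ} {ρ : Matrix n n ℂ} (hK : IsRealKraus K)
    (h : IsState ρ) :
    ∑ l, (K l * ρ * (K l)ᵀ).trace.re *
      MRe m ((K l * ρ * (K l)ᵀ).trace⁻¹ • (K l * ρ * (K l)ᵀ)) ≤ MRe n ρ := by
  have hF := fidelity_le_sum hK.2 h.1 (rePart_posSemidef h.1)
  have ht := congrArg Complex.re (sum_trace_conj hK.2 ρ)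
  rw [h.2, Complex.re_sum, Complex.one_re] at ht
  simp only [← (hK.1 _).conjTranspose_eq, trace_mul_MRe (h.1.mul_mul_conjTranspose_same _),
    rePart_conj (hK.1 _), Finset.sum_sub_distrib, ht]
  exact sub_le_sub_left hF 1

theorem MRe_convex {p : ι → ℝ} {ρ : ι → Matrix n n ℂ} (hp : ∀ j, 0 ≤ p j) (hs : ∑ j, p j = 1)
    (h : ∀ j, IsState (ρ j)) : MRe n (∑ j, (p j : ℂ) • ρ j) ≤ ∑ j, p j * MRe n (ρ j) := by
  have hσ j := rePart_posSemidef (h j).1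
  have hp' j : (0 : ℂ) ≤ (p j : ℂ) := Complex.zero_le_real.2 (hp j)
  have hF := sum_fidelity_le (fun j => (h j).1.smul (hp' j)) fun j => (hσ j).smul (hp' j)
  simp only [fidelity_smul (hp _) (h _).1 (hσ _)] at hF
  simp only [MRe, mul_sub, mul_one, Finset.sum_sub_distrib, hs, rePart_sum, rePart_smul]
  exact sub_le_sub_left hF 1

/-- The diagonal blocks of a coupling of the direct sums are couplings of the summands and carry its
whole trace. Conversely, couplings of the summands embed block-diagonally. -/
theorem fidelity_directSum {A A' : Matrix m m ℂ} {B B' : Matrix n n ℂ} (hA : A.PosSemidef)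
    (hA' : A'.PosSemidef) (hB : B.PosSemidef) (hB' : B'.PosSemidef) :
    fidelity (directSum A B) (directSum A' B') = fidelity A A' + fidelity B B' := by
  apply le_antisymm
  · obtain ⟨X, hX, h⟩ := exists_coupling_eq (ρ := directSum A B) (σ := directSum A' B')
      (hA.fromBlocks_diagonal hB) (hA'.fromBlocks_diagonal hB')
    have h₁ : IsCoupling A A' X.toBlocks₁₁ := by
      unfold IsCoupling
      convert PosSemidef.submatrix hX (Sum.map Sum.inl Sum.inl : m ⊕ m → _) using 1
      ext (i | i) (j | j) <;> simp [directSum, toBlocks₁₁]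
    have h₂ : IsCoupling B B' X.toBlocks₂₂ := by
      unfold IsCoupling
      convert PosSemidef.submatrix hX (Sum.map Sum.inr Sum.inr : n ⊕ n → _) using 1
      ext (i | i) (j | j) <;> simp [directSum, toBlocks₂₂]
    have ht : X.trace = X.toBlocks₁₁.trace + X.toBlocks₂₂.trace := by
      simp [trace, toBlocks₁₁, toBlocks₂₂]
    rw [← h, ht, Complex.add_re]
    exact add_le_add h₁.re_trace_le h₂.re_trace_le
  · obtain ⟨X, hX, h⟩ := exists_coupling_eq hA hA'
    obtain ⟨Y, hY, h'⟩ := exists_coupling_eq hB hB'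
    set E₁ : Matrix (m ⊕ n) m ℂ := fromRows 1 0 with hE₁
    set E₂ : Matrix (m ⊕ n) n ℂ := fromRows 0 1 with hE₂
    have hXY := (hX.conj E₁).add (hY.conj E₂)
    have hd (C : Matrix m m ℂ) (D : Matrix n n ℂ) :
        E₁ * C * E₁ᴴ + E₂ * D * E₂ᴴ = directSum C D := by
      rw [hE₁, hE₂, conjTranspose_fromRows_eq_fromCols_conjTranspose,
        conjTranspose_fromRows_eq_fromCols_conjTranspose, fromRows_mul _ _ C,
        fromRows_mul _ _ D, fromRows_mul_fromCols, fromRows_mul_fromCols, fromBlocks_add]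
      simp [directSum]
    rw [hd, hd, hd] at hXY
    have := hXY.re_trace_le
    have ht : (directSum X Y).trace = X.trace + Y.trace := by simp [trace, directSum]
    rwa [ht, Complex.add_re, h, h'] at this

theorem MRe_directSum {p : ℝ} {ρ₁ : Matrix m m ℂ} {ρ₂ : Matrix n n ℂ} (hp : 0 ≤ p) (hp' : p ≤ 1)
    (h₁ : IsState ρ₁) (h₂ : IsState ρ₂) :
    MRe (m ⊕ n) (directSum ((p : ℂ) • ρ₁) (((1 - p : ℝ) : ℂ) • ρ₂)) =
      p * MRe m ρ₁ + (1 - p) * MRe n ρ₂ := by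
  have hq : 0 ≤ 1 - p := sub_nonneg.2 hp'
  have hσ₁ := rePart_posSemidef h₁.1
  have hσ₂ := rePart_posSemidef h₂.1
  rw [MRe, rePart_directSum, rePart_smul, rePart_smul,
    fidelity_directSum (h₁.1.smul (Complex.zero_le_real.2 hp))
      (hσ₁.smul (Complex.zero_le_real.2 hp)) (h₂.1.smul (Complex.zero_le_real.2 hq))
      (hσ₂.smul (Complex.zero_le_real.2 hq)), fidelity_smul hp h₁.1 hσ₁,
    fidelity_smul hq h₂.1 hσ₂, MRe, MRe]
  ring

theorem isImaginarityMeasure_MRe : IsImaginarityMeasure MRe where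
  nonneg _ _ _ _ h := MRe_nonneg h
  faithful _ _ _ _ h := MRe_eq_zero_iff h
  mono _ _ _ _ _ _ _ _ _ _ hK h := MRe_mono hK h
  prob_mono _ _ _ _ _ _ _ _ _ _ hK h := MRe_prob_mono hK h
  convex _ _ _ _ _ _ _ hp hs h := MRe_convex hp hs h
  add_directSum _ _ _ _ _ _ _ _ _ hp hp' h₁ h₂ := MRe_directSum hp hp' h₁ h₂

theorem MRe_le {ρ : Matrix n n ℂ} (h : IsState ρ) : MRe n ρ ≤ 1 - √2 / 2 := by
  -- As `Re ρ = ρ/2 + ρ*/2`, the block matrix is the conjugation of `ρ` by the column `(1, 1/√2)`,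
  -- plus `0 ⊕ ρ*/2`.
  have hX : IsCoupling ρ (rePart ρ) (((√2 / 2 : ℝ) : ℂ) • ρ) := by
    have h₁ := h.1.mul_mul_conjTranspose_same
      (fromRows 1 (((√2 / 2 : ℝ) : ℂ) • 1) : Matrix (n ⊕ n) n ℂ)
    have h₂ := (PosSemidef.zero : (0 : Matrix n n ℂ).PosSemidef).fromBlocks_diagonal
      ((map_conj_posSemidef h.1).smul (show (0 : ℂ) ≤ 1 / 2 by norm_num [Complex.le_def]))
    unfold IsCoupling
    convert h₁.add h₂ using 1
    have hs : ((√2 / 2 : ℝ) : ℂ) * ((√2 / 2 : ℝ) : ℂ) = 1 / 2 := by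
      rw [← Complex.ofReal_mul, div_mul_div_comm, Real.mul_self_sqrt zero_le_two]
      norm_num
    rw [conjTranspose_fromRows_eq_fromCols_conjTranspose, fromRows_mul, fromRows_mul_fromCols,
      fromBlocks_add, conjTranspose_smul, conjTranspose_smul, h.1.1.eq, rePart, smul_add]
    simp only [conjTranspose_one, Matrix.mul_one, Matrix.one_mul, Matrix.smul_mul,
      Matrix.mul_smul, smul_smul, hs, add_zero, Complex.star_def, Complex.conj_ofReal]
  have := hX.re_trace_le
  rw [trace_smul, h.2, smul_eq_mul, mul_one, Complex.ofReal_re] at this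
  rw [MRe]
  linarith

end Measure

/-! ### Pure states and geometric imaginarity. -/

section Pure

variable {n : Type} [Fintype n]

theorem isState_ketBra {ψ : n → ℂ} (hψ : star ψ ⬝ᵥ ψ = 1) : IsState (ketBra ψ) :=
  ⟨posSemidef_vecMulVec_self_star ψ, by rw [ketBra, trace_vecMulVec, dotProduct_comm, hψ]⟩

theorem ketBra_mul_ketBra {ψ : n → ℂ} (A : Matrix n n ℂ) :
    ketBra ψ * A * ketBra ψ = (star ψ ⬝ᵥ A *ᵥ ψ) • ketBra ψ := by
  rw [ketBra, Matrix.mul_assoc, mul_vecMulVec, vecMulVec_mul_vecMulVec, vecMulVec_smul]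

theorem star_dotProduct_ketBra_mulVec (φ ψ : n → ℂ) :
    star ψ ⬝ᵥ ketBra φ *ᵥ ψ = ((‖star φ ⬝ᵥ ψ‖ ^ 2 : ℝ) : ℂ) := by
  have : star ψ ⬝ᵥ φ = star (star φ ⬝ᵥ ψ) := star_dotProduct ψ φ
  rw [ketBra, vecMulVec_mulVec]
  rw [op_smul_eq_smul, dotProduct_smul, smul_eq_mul, this, Complex.star_def, Complex.mul_conj, Complex.normSq_eq_norm_sq]

theorem re_rePart_ketBra {ψ : n → ℂ} (hψ : star ψ ⬝ᵥ ψ = 1) :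
    (star ψ ⬝ᵥ rePart (ketBra ψ) *ᵥ ψ).re = 1 / 2 * (1 + ‖star ψ ⬝ᵥ star ψ‖ ^ 2) := by
  have h₁ : (ketBra ψ).map (starRingEnd ℂ) = ketBra (star ψ) := by
    ext i j
    simp [ketBra, vecMulVec_apply]
  have h₂ : ‖star (star ψ) ⬝ᵥ ψ‖ = ‖star ψ ⬝ᵥ star ψ‖ := by
    rw [star_dotProduct, norm_star]
  rw [rePart, h₁, smul_mulVec, add_mulVec, dotProduct_smul, dotProduct_add,
    star_dotProduct_ketBra_mulVec, star_dotProduct_ketBra_mulVec, hψ, h₂, norm_one, one_pow,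
    ← Complex.ofReal_add, smul_eq_mul, mul_comm, Complex.re_ofReal_mul]
  norm_num
  ring

/-- A unit vector and its conjugate form a frame with upper frame bound `1 + |⟨ψ|ψ*⟩|`. -/
theorem frame_bound {ψ : n → ℂ} (hψ : star ψ ⬝ᵥ ψ = 1) (v : n → ℂ) :
    ‖star ψ ⬝ᵥ v‖ ^ 2 + ‖star (star ψ) ⬝ᵥ v‖ ^ 2 ≤
      (1 + ‖star ψ ⬝ᵥ star ψ‖) * (star v ⬝ᵥ v).re := by
  set x := star ψ ⬝ᵥ v with hx
  set y := star (star ψ) ⬝ᵥ v with hy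
  set z := star ψ ⬝ᵥ star ψ with hz
  have hψ' : ψ ⬝ᵥ star ψ = 1 := by rw [dotProduct_comm, hψ]
  have hz' : ψ ⬝ᵥ ψ = star z := by rw [hz, star_dotProduct_star, star_star]
  have hx' : star v ⬝ᵥ ψ = star x := by rw [hx, star_dotProduct]
  have hy' : star v ⬝ᵥ star ψ = star y := by rw [hy, star_dotProduct, star_star]
  rw [star_star] at hy
  -- Expand `‖(1 + |z|) v - (x ψ + y ψ*)‖² ≥ 0`. Once the cross term is bounded by `|z| (|x|² +
  -- |y|²)`, a factor `1 + |z|` cancels.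
  have h := (Complex.le_def.1 (dotProduct_star_self_nonneg
    ((((1 + ‖z‖ : ℝ) : ℂ) • v) - (x • ψ + y • star ψ)))).1
  have hxy : (star x * y * z).re ≤ ‖z‖ * ((‖x‖ ^ 2 + ‖y‖ ^ 2) / 2) := by
    refine (Complex.re_le_norm _).trans ?_
    rw [norm_mul, norm_mul, norm_star]
    nlinarith [sq_nonneg (‖x‖ - ‖y‖), norm_nonneg z]
  have hexp : (star ((((1 + ‖z‖ : ℝ) : ℂ) • v) - (x • ψ + y • star ψ)) ⬝ᵥ
      ((((1 + ‖z‖ : ℝ) : ℂ) • v) - (x • ψ + y • star ψ))).re =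
      (1 + ‖z‖) ^ 2 * (star v ⬝ᵥ v).re - 2 * (1 + ‖z‖) * (‖x‖ ^ 2 + ‖y‖ ^ 2) +
        (‖x‖ ^ 2 + ‖y‖ ^ 2 + 2 * (star x * y * z).re) := by
    simp only [star_sub, star_add, star_smul, star_star, sub_dotProduct, dotProduct_sub,
      add_dotProduct, dotProduct_add, smul_dotProduct, dotProduct_smul, smul_eq_mul, hψ, hψ', hz',
      hx', hy', ← hx, ← hy, ← hz, ← Complex.normSq_eq_norm_sq, Complex.normSq_apply]
    simp
    ring
  rw [hexp, Complex.zero_re] at h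
  have hs := norm_nonneg z
  have : 0 ≤ (1 + ‖z‖) * ((1 + ‖z‖) * (star v ⬝ᵥ v).re - (‖x‖ ^ 2 + ‖y‖ ^ 2)) := by nlinarith
  have := nonneg_of_mul_nonneg_right this (by linarith)
  linarith

theorem IsReal.star_dotProduct_mulVec {σ : Matrix n n ℂ} (h : IsReal σ) (ψ : n → ℂ) :
    star (star ψ) ⬝ᵥ σ *ᵥ star ψ = star (star ψ ⬝ᵥ σ *ᵥ ψ) := by
  have hr (i j) : (starRingEnd ℂ) (σ i j) = σ i j := Complex.conj_eq_iff_im.2 (h i j)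
  simp [dotProduct, mulVec, hr]

theorem trace_mul_ketBra (σ : Matrix n n ℂ) (ψ : n → ℂ) :
    (σ * ketBra ψ).trace = star ψ ⬝ᵥ σ *ᵥ ψ := by
  rw [ketBra, mul_vecMulVec, trace_vecMulVec, dotProduct_comm]

/-- By `frame_bound`, `G = (1 + s) 1 - |ψ⟩⟨ψ| - |ψ*⟩⟨ψ*|` is positive semidefinite. In `Tr (σ G) ≥
0` the two projectors contribute equally because `σ` is real. -/
theorem re_expectation_le {ψ : n → ℂ} (hψ : star ψ ⬝ᵥ ψ = 1) {σ : Matrix n n ℂ} (hσ : IsState σ)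
    (hr : IsReal σ) : (star ψ ⬝ᵥ σ *ᵥ ψ).re ≤ (1 + ‖star ψ ⬝ᵥ star ψ‖) / 2 := by
  classical
  set s : ℝ := ‖star ψ ⬝ᵥ star ψ‖
  have hH : (((1 + s : ℝ) : ℂ) • (1 : Matrix n n ℂ) - ketBra ψ - ketBra (star ψ)).IsHermitian := by
    refine ((?_ : IsHermitian _).sub (posSemidef_vecMulVec_self_star ψ).1).sub
      (posSemidef_vecMulVec_self_star (star ψ)).1
    rw [IsHermitian, conjTranspose_smul, conjTranspose_one, Complex.star_def, Complex.conj_ofReal]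
  have hG : (((1 + s : ℝ) : ℂ) • (1 : Matrix n n ℂ) - ketBra ψ - ketBra (star ψ)).PosSemidef := by
    refine PosSemidef.of_dotProduct_mulVec_nonneg hH fun v => ?_
    rw [Complex.le_def]
    have hv := Complex.le_def.1 (dotProduct_star_self_nonneg v)
    have := frame_bound hψ v
    simp only [sub_mulVec, smul_mulVec, one_mulVec, dotProduct_sub, dotProduct_smul,
      star_dotProduct_ketBra_mulVec, smul_eq_mul, Complex.sub_re, Complex.sub_im,
      Complex.re_ofReal_mul, Complex.im_ofReal_mul, Complex.ofReal_re, Complex.ofReal_im, ← hv.2,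
      Complex.zero_re, Complex.zero_im]
    exact ⟨by linarith, by simp⟩
  obtain ⟨B, hB⟩ := CStarAlgebra.nonneg_iff_eq_star_mul_self.1 hσ.1.nonneg
  rw [star_eq_conjTranspose] at hB
  have h := (Complex.le_def.1 (hG.mul_mul_conjTranspose_same B).trace_nonneg).1
  rw [Matrix.mul_assoc, trace_mul_comm, Matrix.mul_assoc, ← hB, trace_mul_comm, Matrix.mul_sub,
    Matrix.mul_sub, trace_sub, trace_sub, trace_mul_ketBra, trace_mul_ketBra,
    hr.star_dotProduct_mulVec, Matrix.mul_smul, Matrix.mul_one, trace_smul, hσ.2] at h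
  simp at h
  linarith

theorem exists_phase (z : ℂ) : ∃ c : ℂ, ‖c‖ = 1 ∧ c * c * z = (‖z‖ : ℂ) := by
  refine ⟨Complex.exp ((-(z.arg / 2) : ℝ) * Complex.I), Complex.norm_exp_ofReal_mul_I _, ?_⟩
  nth_rewrite 3 [← Complex.norm_mul_exp_arg_mul_I z]
  rw [← Complex.exp_add, mul_left_comm, ← Complex.exp_add]
  have : ((-(z.arg / 2) : ℝ) : ℂ) * Complex.I + ((-(z.arg / 2) : ℝ) : ℂ) * Complex.I +
      z.arg * Complex.I = 0 := by push_cast; ring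
  rw [this, Complex.exp_zero, mul_one]

/-- Choose the phase of `φ = c ψ` so that `φ ⬝ᵥ φ = s ≥ 0`. Its real part `a` then has `a ⬝ᵥ a = a
⬝ᵥ φ = (1 + s)/2`, so the normalized projector onto `a` is optimal. -/
theorem exists_real_state_expectation_eq {ψ : n → ℂ} (hψ : star ψ ⬝ᵥ ψ = 1) :
    ∃ σ : Matrix n n ℂ, IsState σ ∧ IsReal σ ∧
      (star ψ ⬝ᵥ σ *ᵥ ψ).re = (1 + ‖star ψ ⬝ᵥ star ψ‖) / 2 := by
  obtain ⟨c, hc, hcz⟩ := exists_phase (ψ ⬝ᵥ ψ)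
  have hz : ‖star ψ ⬝ᵥ star ψ‖ = ‖ψ ⬝ᵥ ψ‖ := by rw [star_dotProduct_star, norm_star]
  rw [hz]
  set s : ℝ := ‖ψ ⬝ᵥ ψ‖
  have hs : 0 ≤ s := norm_nonneg _
  have hcc : star c * c = 1 := by
    rw [Complex.star_def, ← Complex.normSq_eq_conj_mul_self, Complex.normSq_eq_norm_sq, hc]
    norm_num
  set φ := c • ψ with hφ
  have h₁ : φ ⬝ᵥ φ = (s : ℂ) := by
    rw [hφ, smul_dotProduct, dotProduct_smul, smul_smul, smul_eq_mul, hcz]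
  have h₂ : star φ ⬝ᵥ φ = 1 := by
    rw [hφ, star_smul, smul_dotProduct, dotProduct_smul, hψ, smul_smul, hcc, one_smul]
  have h₃ : star φ ⬝ᵥ star φ = (s : ℂ) := by
    rw [star_dotProduct_star, h₁, Complex.star_def, Complex.conj_ofReal]
  have h₂' : φ ⬝ᵥ star φ = 1 := by rw [dotProduct_comm, h₂]
  set a : n → ℂ := (1 / 2 : ℂ) • (φ + star φ) with ha
  have ha' : star a = a := by
    rw [ha, star_smul, star_add, star_star, add_comm (star φ)]
    simp
  have haa : a ⬝ᵥ a = (((1 + s) / 2 : ℝ) : ℂ) := by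
    simp only [ha, smul_dotProduct, dotProduct_smul, add_dotProduct, dotProduct_add, h₁, h₂, h₃,
      h₂', smul_eq_mul]
    push_cast
    ring
  have haφ : a ⬝ᵥ φ = (((1 + s) / 2 : ℝ) : ℂ) := by
    simp only [ha, smul_dotProduct, add_dotProduct, h₁, h₂, smul_eq_mul]
    push_cast
    ring
  have haψ : ‖star a ⬝ᵥ ψ‖ = (1 + s) / 2 := by
    have : ‖a ⬝ᵥ φ‖ = ‖a ⬝ᵥ ψ‖ := by rw [hφ, dotProduct_smul, norm_smul, hc, one_mul]
    rw [ha', ← this, haφ, Complex.norm_real, Real.norm_of_nonneg (by linarith)]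
  refine ⟨((2 / (1 + s) : ℝ) : ℂ) • ketBra a, ⟨?_, ?_⟩, ?_, ?_⟩
  · exact (posSemidef_vecMulVec_self_star a).smul (Complex.zero_le_real.2 (by positivity))
  · rw [ketBra, trace_smul, trace_vecMulVec, ha', haa, smul_eq_mul, ← Complex.ofReal_mul]
    norm_cast
    field_simp
  · refine IsReal.smul (fun i j => ?_) (Complex.ofReal_im _)
    have hi (k) : (a k).im = 0 := Complex.conj_eq_iff_im.1 (congrFun ha' k)
    rw [ketBra, vecMulVec_apply, ha', Complex.mul_im, hi, hi]
    ring
  · rw [smul_mulVec, dotProduct_smul, star_dotProduct_ketBra_mulVec, haψ, smul_eq_mul,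
      ← Complex.ofReal_mul, Complex.ofReal_re]
    field_simp

variable [DecidableEq n]

/-- A projector is its own square root, and compressing `σ` by `|ψ⟩⟨ψ|` leaves a multiple of that
projector. -/
theorem fidelity_ketBra {ψ : n → ℂ} (hψ : star ψ ⬝ᵥ ψ = 1) {σ : Matrix n n ℂ}
    (hσ : σ.PosSemidef) : fidelity (ketBra ψ) σ = √(star ψ ⬝ᵥ σ *ᵥ ψ).re := by
  have hP := (isState_ketBra hψ).1
  have hPP : ketBra ψ * ketBra ψ = ketBra ψ := by
    simpa [hψ] using ketBra_mul_ketBra (ψ := ψ) 1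
  have h₁ : CFC.sqrt (ketBra ψ) = ketBra ψ := CFC.sqrt_unique hPP hP.nonneg
  have h₂ := Complex.le_def.1 (hσ.dotProduct_mulVec_nonneg ψ)
  set r := (star ψ ⬝ᵥ σ *ᵥ ψ).re
  have hr : star ψ ⬝ᵥ σ *ᵥ ψ = (r : ℂ) := Complex.ext rfl (by simpa using h₂.2.symm)
  have h₃ : CFC.sqrt (ketBra ψ * σ * ketBra ψ) = ((√r : ℝ) : ℂ) • ketBra ψ := by
    refine CFC.sqrt_unique ?_ (hP.smul (Complex.zero_le_real.2 (Real.sqrt_nonneg r))).nonneg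
    rw [smul_mul_smul_comm, hPP, ketBra_mul_ketBra, hr, ← Complex.ofReal_mul,
      Real.mul_self_sqrt h₂.1]
  rw [fidelity, h₁, h₃, trace_smul, (isState_ketBra hψ).2, smul_eq_mul, mul_one,
    Complex.ofReal_re]

theorem MRe_ketBra {ψ : n → ℂ} (hψ : star ψ ⬝ᵥ ψ = 1) :
    MRe n (ketBra ψ) = 1 - 1 / √2 * √(1 + ‖star ψ ⬝ᵥ star ψ‖ ^ 2) := by
  rw [MRe, fidelity_ketBra hψ (rePart_posSemidef (isState_ketBra hψ).1), re_rePart_ketBra hψ,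
    Real.sqrt_mul (by norm_num), Real.sqrt_div zero_le_one, Real.sqrt_one]

theorem isGreatest_sqFidelitiesToReal {ψ : n → ℂ} (hψ : star ψ ⬝ᵥ ψ = 1) :
    IsGreatest (sqFidelitiesToReal (ketBra ψ)) ((1 + ‖star ψ ⬝ᵥ star ψ‖) / 2) := by
  have hF {σ : Matrix n n ℂ} (hσ : IsState σ) :
      fidelity (ketBra ψ) σ ^ 2 = (star ψ ⬝ᵥ σ *ᵥ ψ).re := by
    rw [fidelity_ketBra hψ hσ.1,
      Real.sq_sqrt (Complex.le_def.1 (hσ.1.dotProduct_mulVec_nonneg ψ)).1]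
  refine ⟨?_, ?_⟩
  · obtain ⟨σ, hσ, hr, h⟩ := exists_real_state_expectation_eq hψ
    exact ⟨σ, hσ, hr, by rw [hF hσ, h]⟩
  · rintro _ ⟨σ, hσ, hr, rfl⟩
    exact hF hσ ▸ re_expectation_le hψ hσ hr

theorem Mg_ketBra {ψ : n → ℂ} (hψ : star ψ ⬝ᵥ ψ = 1) :
    Mg (ketBra ψ) = 1 - (1 + ‖star ψ ⬝ᵥ star ψ‖) / 2 := by
  rw [Mg, (isGreatest_sqFidelitiesToReal hψ).csSup_eq]

theorem plusI_unit {j k : n} (h : j ≠ k) : star (plusI j k) ⬝ᵥ plusI j k = 1 := by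
  have h₂ : ((√2 : ℝ) : ℂ)⁻¹ * ((√2 : ℝ) : ℂ)⁻¹ = 1 / 2 := by
    rw [← mul_inv, ← Complex.ofReal_mul, Real.mul_self_sqrt zero_le_two]
    norm_num
  simp only [plusI, star_smul, star_add, smul_dotProduct, dotProduct_smul, smul_eq_mul,
    Complex.star_def, map_inv₀, Complex.conj_ofReal, dotProduct_add, add_dotProduct]
  rw [← mul_add, ← mul_assoc, h₂]
  simp [dotProduct_single, h, h.symm]
  norm_num

theorem plusI_conj_orthogonal {j k : n} (h : j ≠ k) :
    star (plusI j k) ⬝ᵥ star (plusI j k) = 0 := by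
  rw [star_dotProduct_star, star_eq_zero]
  simp only [plusI, smul_dotProduct, dotProduct_smul, dotProduct_add, add_dotProduct]
  simp [dotProduct_single, h, h.symm]

/-! ### Real rank-one projections. -/

theorem IsRealRankOneProj.exists_conj_eq {P : Matrix n n ℂ} (hP : IsRealRankOneProj P)
    (A : Matrix n n ℂ) : ∃ c : ℂ, P * A * P = c • P := by
  have h := hP.2.2.1
  rw [Matrix.rank, finrank_eq_one_iff'] at h
  obtain ⟨v, -, hv⟩ := h
  choose c hc using fun j => hv ⟨P *ᵥ Pi.single j 1, LinearMap.mem_range_self P.mulVecLin _⟩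
  -- Every column of `P` is a multiple `c j` of the vector spanning its range.
  have hPv : P = vecMulVec v.1 c := by
    ext i j
    have := congrFun (congrArg Subtype.val (hc j)) i
    simp at this
    rw [vecMulVec_apply, ← this, mul_comm]
  refine ⟨c ⬝ᵥ A *ᵥ v.1, ?_⟩
  generalize v.1 = w at hPv
  rw [hPv, Matrix.mul_assoc, mul_vecMulVec, vecMulVec_mul_vecMulVec, vecMulVec_smul]

/-- The compression is a scalar multiple of `P`; being Hermitian with `P ≠ 0`, it has a real scalar.
-/
theorem IsRealRankOneProj.isReal_conj {P : Matrix n n ℂ} (hP : IsRealRankOneProj P)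
    {A : Matrix n n ℂ} (hA : A.IsHermitian) : IsReal (P * A * P) := by
  obtain ⟨c, hc⟩ := hP.exists_conj_eq A
  have hP0 : P ≠ 0 := by
    rintro rfl
    simpa using hP.2.2.1
  have hH : (P * A * P)ᴴ = P * A * P := by
    simp only [conjTranspose_mul, hP.1.eq, hA.eq, Matrix.mul_assoc]
  rw [hc, conjTranspose_smul, hP.1.eq] at hH
  rw [hc]
  exact hP.2.2.2.smul (Complex.conj_eq_iff_im.1 (smul_left_injective ℂ hP0 hH))

/-- Both sides are zero, since each `P i * ρ * P i` is real and hence so is the sum. -/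
theorem MRe_sum_rankOneProj {ι : Type} [Fintype ι] {P : ι → Matrix n n ℂ} {ρ : Matrix n n ℂ}
    (hP : ∀ i, IsRealRankOneProj (P i)) (hρ : IsState ρ) (h : IsState (∑ i, P i * ρ * P i)) :
    MRe n (∑ i, P i * ρ * P i) =
      ∑ i, (P i * ρ * P i).trace.re *
        MRe n ((P i * ρ * P i).trace⁻¹ • (P i * ρ * P i)) := by
  have hr i := (hP i).isReal_conj hρ.1.1
  rw [(MRe_eq_zero_iff h).2 (IsReal.sum hr)]
  refine (Finset.sum_eq_zero fun i _ => ?_).symm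
  have hpos : (P i * ρ * P i).PosSemidef := by
    simpa [(hP i).1.eq] using hρ.1.conjTranspose_mul_mul_same (P i)
  rw [trace_mul_MRe hpos, rePart_eq_self_iff.2 (hr i), fidelity_self hpos, sub_self]

end Pure

end Imaginarity

end

open Imaginarity Matrix in
theorem theorem2 :
    IsImaginarityMeasure MRe ∧
    (∀ (n : Type) [Fintype n] [DecidableEq n] (ρ : Matrix n n ℂ), IsState ρ →
      0 ≤ MRe n ρ ∧ MRe n ρ ≤ 1 - Real.sqrt 2 / 2 ∧ (MRe n ρ = 0 ↔ IsReal ρ)) ∧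
    (∀ (n : Type) [Fintype n] [DecidableEq n] (j k : n), j ≠ k →
      IsState (ketBra (plusI j k)) ∧ MRe n (ketBra (plusI j k)) = 1 - Real.sqrt 2 / 2) ∧
    (∀ (n : Type) [Fintype n] [DecidableEq n] (ψ : n → ℂ), star ψ ⬝ᵥ ψ = 1 →
      MRe n (ketBra ψ) = 1 - 1 / Real.sqrt 2 * Real.sqrt (1 + ‖star ψ ⬝ᵥ star ψ‖ ^ 2)) ∧
    (∀ (n : Type) [Fintype n] [DecidableEq n] (ψ : n → ℂ), star ψ ⬝ᵥ ψ = 1 →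
      IsGreatest (sqFidelitiesToReal (ketBra ψ)) (1 - Mg (ketBra ψ)) ∧
      MRe n (ketBra ψ) = 1 - 1 / Real.sqrt 2 * Real.sqrt (1 + (1 - 2 * Mg (ketBra ψ)) ^ 2)) ∧
    (∀ (n ι : Type) [Fintype n] [DecidableEq n] [Fintype ι]
      (P : ι → Matrix n n ℂ) (ρ : Matrix n n ℂ),
      (∀ i, IsRealRankOneProj (P i)) → IsState ρ → IsState (∑ i, P i * ρ * P i) →
      MRe n (∑ i, P i * ρ * P i) =
        ∑ i, (P i * ρ * P i).trace.re *
          MRe n ((P i * ρ * P i).trace⁻¹ • (P i * ρ * P i))) := by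
  refine ⟨isImaginarityMeasure_MRe,
    fun n _ _ ρ h => ⟨MRe_nonneg h, MRe_le h, MRe_eq_zero_iff h⟩,
    fun n _ _ j k h => ⟨isState_ketBra (plusI_unit h), ?_⟩,
    fun n _ _ ψ hψ => MRe_ketBra hψ, fun n _ _ ψ hψ => ?_,
    fun n ι _ _ _ P ρ hP hρ h => MRe_sum_rankOneProj hP hρ h⟩
  · rw [MRe_ketBra (plusI_unit h), plusI_conj_orthogonal h, ← Real.sqrt_div_self']
    simp
  · rw [MRe_ketBra hψ, Mg_ketBra hψ, sub_sub_cancel]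
    refine ⟨isGreatest_sqFidelitiesToReal hψ, ?_⟩
    -- Here `1 - 2 M_g` equals `|⟨ψ|ψ*⟩|`, which reduces the claim to the pure-state formula.
    ring_nf
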